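/- For integers $k,p\ge 3$ let $D_{k,p}$ be the directed graph made by a $k$-clique (all arcs between distinct nodes, no loops) and a directed $p$-cycle, connected by a bidirectional bridge $x\leftrightarrow y$, where $x$ is a node of the clique and $y$ is a node of the cycle. Let $A$ be its adjacency matrix ($A_{ij}=1$ if there is an arc $i\to j$, and $A_{ij}=0$ otherwise). A left dominant eigenvector of $A$ is a nonzero real row vector $v$ with $vA=\lambda v$, where $\lambda$ is a real positive eigenvalue of $A$ whose absolute value is maximum among all complex eigenvalues of $A$. Theorem (the dominant eigenvector satisfies the density axiom, with no watershed). For all $k,p\ge 3$, the matrix $A$ of $D_{k,p}$ has a left dominant eigenvector with positive entries, which is unique up to a scalar factor among left dominant eigenvectors, and every left dominant eigenvector $v$ with nonnegative entries satisfies $v_x>v_y$; that is, the clique bridge has a strictly larger score than the cycle bridge. In particular this holds for $k=p$, which is the density axiom. -/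

import Mathlib

open scoped Matrix

/-- The directed graph made by a `k`-clique (on `Fin k`, all arcs between distinct nodes, no loops)
and a directed `p`-cycle (on `Fin p`, arcs `i → i + 1 mod p`), connected by the bidirectional bridge
`x ↔ y`, where `x` is a node of the clique and `y` is a node of the cycle. -/
def cliqueCycleDigraph (k p : ℕ) (x : Fin k) (y : Fin p) : Digraph (Fin k ⊕ Fin p) where
  Adj
    | Sum.inl i, Sum.inl j => i ≠ j
    | Sum.inr i, Sum.inr j => j.val = (i.val + 1) % p
    | Sum.inl i, Sum.inr j => i = x ∧ j = y
    | Sum.inr i, Sum.inl j => i = y ∧ j = x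

open Classical in
/-- The adjacency matrix of a directed graph: the entry `(i, j)` is `1` if there is an arc
`i → j`, and `0` otherwise. -/
noncomputable def digraphAdjMatrix {V : Type*} (G : Digraph V) : Matrix V V ℝ :=
  Matrix.of fun i j => if G.Adj i j then 1 else 0

/-- `lam` is a dominant eigenvalue of the real matrix `A`: it is a real and positive eigenvalue,
and it has maximum absolute value among all complex eigenvalues of `A`. -/
def IsDominantEigenvalue {V : Type*} [Fintype V] [DecidableEq V] (A : Matrix V V ℝ) (lam : ℝ) :
    Prop :=
  0 < lam ∧ (lam : ℂ) ∈ spectrum ℂ (A.map Complex.ofReal) ∧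
    ∀ z ∈ spectrum ℂ (A.map Complex.ofReal), ‖z‖ ≤ lam

/-- `v` is a left dominant eigenvector of `A`: a nonzero row vector with `v A = lam v` for a
dominant eigenvalue `lam` of `A`. -/
def IsLeftDominantEigenvector {V : Type*} [Fintype V] [DecidableEq V] (A : Matrix V V ℝ)
    (v : V → ℝ) : Prop :=
  v ≠ 0 ∧ ∃ lam : ℝ, IsDominantEigenvalue A lam ∧ v ᵥ* A = lam • v

/-!
Write the equations `v A = t v` out. On the clique they say `(t + 1) v i = S`, with `S` the sum of
`v` over the clique, plus an extra term `v y` at `i = x`; on the cycle they say that each step away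
from `y` divides the entry by `t`, plus an extra term `v x` at `y`. Hence, for `t > k - 1`, an
eigenvector is a multiple of one explicit positive vector `dominantVector`, normalised by `v y = 1`,
and this vector is an eigenvector exactly when `t` satisfies one polynomial equation. That equation
has a root above `k - 1` by the intermediate value theorem
(`exists_root_characteristic_equation`).

A nonnegative matrix that has a positive left eigenvector with eigenvalue `t` has all its complex
eigenvalues in the disc of radius `t` (`norm_le_of_pos_left_eigenvector`: pair the eigenvector with
the absolute values of a right eigenvector), so the root is the only dominant eigenvalue, and the
explicit vector spans the left dominant eigenvectors. Finally the equation at `y` reads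
`v x = (t - t ^ (1 - p)) v y`, and the factor exceeds `1` because `t > k - 1 ≥ 2`.
-/

/-! ### Dominant eigenvalues of nonnegative matrices -/

theorem Matrix.mem_spectrum_iff_det_eq_zero {V K : Type*} [Fintype V] [DecidableEq V] [Field K]
    (M : Matrix V V K) (z : K) :
    z ∈ spectrum K M ↔ (algebraMap K (Matrix V V K) z - M).det = 0 := by
  rw [spectrum.mem_iff, Matrix.isUnit_iff_isUnit_det, isUnit_iff_ne_zero, not_not]

theorem mem_spectrum_of_left_eigenvector {V : Type*} [Fintype V] [DecidableEq V]
    {A : Matrix V V ℝ} {v : V → ℝ} {t : ℝ} (hv : v ≠ 0) (h : v ᵥ* A = t • v) :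
    (t : ℂ) ∈ spectrum ℂ (A.map Complex.ofReal) := by
  rw [Matrix.mem_spectrum_iff_det_eq_zero, ← Matrix.exists_vecMul_eq_zero_iff]
  refine ⟨fun i => (v i : ℂ), fun h0 => hv (funext fun i => ?_), ?_⟩
  · exact Complex.ofReal_eq_zero.mp (congrFun h0 i)
  · rw [Matrix.vecMul_sub, Algebra.algebraMap_eq_smul_one, Matrix.vecMul_smul, Matrix.vecMul_one,
      sub_eq_zero]
    funext j
    have hj := congrFun h j
    simp only [Matrix.vecMul, dotProduct, Pi.smul_apply, smul_eq_mul, Matrix.map_apply] at hj ⊢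
    exact_mod_cast hj.symm

/-- The easy half of Perron's theorem, by pairing the positive left eigenvector with the absolute
values of a right eigenvector for `z`. -/
theorem norm_le_of_pos_left_eigenvector {V : Type*} [Fintype V] [DecidableEq V]
    {A : Matrix V V ℝ} (hA : ∀ i j, 0 ≤ A i j) {v : V → ℝ} (hv : ∀ i, 0 < v i) {t : ℝ}
    (h : v ᵥ* A = t • v) {z : ℂ} (hz : z ∈ spectrum ℂ (A.map Complex.ofReal)) : ‖z‖ ≤ t := by
  rw [Matrix.mem_spectrum_iff_det_eq_zero, ← Matrix.exists_mulVec_eq_zero_iff] at hz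
  obtain ⟨w, hw0, hw⟩ := hz
  rw [Matrix.sub_mulVec, Algebra.algebraMap_eq_smul_one, Matrix.smul_mulVec, Matrix.one_mulVec,
    sub_eq_zero] at hw
  have hle : ∀ i, ‖z‖ * ‖w i‖ ≤ ∑ j, A i j * ‖w j‖ := fun i => by
    have hi := congrFun hw i
    simp only [Matrix.mulVec, dotProduct, Pi.smul_apply, smul_eq_mul, Matrix.map_apply] at hi
    rw [← norm_mul, hi]
    refine (norm_sum_le _ _).trans (Finset.sum_le_sum fun j _ => ?_)
    rw [norm_mul, Complex.norm_real, Real.norm_of_nonneg (hA i j)]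
  have hpos : 0 < ∑ i, v i * ‖w i‖ := by
    obtain ⟨i, hi⟩ := Function.ne_iff.mp hw0
    exact Finset.sum_pos' (fun i _ => mul_nonneg (hv i).le (norm_nonneg _))
      ⟨i, Finset.mem_univ i, mul_pos (hv i) (norm_pos_iff.mpr hi)⟩
  refine le_of_mul_le_mul_right ?_ hpos
  calc ‖z‖ * ∑ i, v i * ‖w i‖ = ∑ i, v i * (‖z‖ * ‖w i‖) := by
        rw [Finset.mul_sum]; exact Finset.sum_congr rfl fun i _ => by ring
    _ ≤ ∑ i, v i * ∑ j, A i j * ‖w j‖ :=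
        Finset.sum_le_sum fun i _ => mul_le_mul_of_nonneg_left (hle i) (hv i).le
    _ = ∑ j, (v ᵥ* A) j * ‖w j‖ := by
        simp only [Matrix.vecMul, dotProduct, Finset.mul_sum, Finset.sum_mul]
        rw [Finset.sum_comm]
        exact Finset.sum_congr rfl fun i _ => Finset.sum_congr rfl fun j _ => by ring
    _ = t * ∑ i, v i * ‖w i‖ := by
        rw [h, Finset.mul_sum]
        exact Finset.sum_congr rfl fun i _ => by simp only [Pi.smul_apply, smul_eq_mul]; ring

theorem isDominantEigenvalue_of_pos_left_eigenvector {V : Type*} [Fintype V] [DecidableEq V]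
    [Nonempty V] {A : Matrix V V ℝ} (hA : ∀ i j, 0 ≤ A i j) {v : V → ℝ} (hv : ∀ i, 0 < v i)
    {t : ℝ} (ht : 0 < t) (h : v ᵥ* A = t • v) : IsDominantEigenvalue A t := by
  refine ⟨ht, mem_spectrum_of_left_eigenvector (fun h0 => ?_) h,
    fun z hz => norm_le_of_pos_left_eigenvector hA hv h hz⟩
  obtain ⟨i⟩ := ‹Nonempty V›
  exact (hv i).ne' (congrFun h0 i)

theorem IsDominantEigenvalue.eq {V : Type*} [Fintype V] [DecidableEq V] {A : Matrix V V ℝ}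
    {s t : ℝ} (hs : IsDominantEigenvalue A s) (ht : IsDominantEigenvalue A t) : s = t := by
  have h1 := ht.2.2 _ hs.2.1
  have h2 := hs.2.2 _ ht.2.1
  rw [Complex.norm_real, Real.norm_of_nonneg hs.1.le] at h1
  rw [Complex.norm_real, Real.norm_of_nonneg ht.1.le] at h2
  exact le_antisymm h1 h2

/-! ### The eigenvector equations of the clique-cycle digraph -/

theorem digraphAdjMatrix_nonneg {V : Type*} (G : Digraph V) (i j : V) :
    0 ≤ digraphAdjMatrix G i j := by
  simp only [digraphAdjMatrix, Matrix.of_apply]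
  split_ifs <;> norm_num

theorem vecMul_cliqueCycle_inl {k p : ℕ} (x : Fin k) (y : Fin p) (w : Fin k ⊕ Fin p → ℝ)
    (j : Fin k) :
    (w ᵥ* digraphAdjMatrix (cliqueCycleDigraph k p x y)) (Sum.inl j) =
      ∑ i, w (Sum.inl i) - w (Sum.inl j) + if j = x then w (Sum.inr y) else 0 := by
  have hcl : ∀ i, digraphAdjMatrix (cliqueCycleDigraph k p x y) (Sum.inl i) (Sum.inl j) =
      1 - if i = j then 1 else 0 := fun i => by
    by_cases hi : i = j <;> simp [digraphAdjMatrix, cliqueCycleDigraph, hi]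
  have hcy : ∀ i, digraphAdjMatrix (cliqueCycleDigraph k p x y) (Sum.inr i) (Sum.inl j) =
      if i = y then if j = x then 1 else 0 else 0 := fun i => by
    by_cases hi : i = y <;> by_cases hj : j = x <;>
      simp [digraphAdjMatrix, cliqueCycleDigraph, hi, hj]
  simp [Matrix.vecMul, dotProduct, Fintype.sum_sum_type, hcl, hcy, mul_sub]

theorem vecMul_cliqueCycle_inr {k n : ℕ} (x : Fin k) (y : Fin (n + 1))
    (w : Fin k ⊕ Fin (n + 1) → ℝ) (j : Fin (n + 1)) :
    (w ᵥ* digraphAdjMatrix (cliqueCycleDigraph k (n + 1) x y)) (Sum.inr j) =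
      w (Sum.inr (j - 1)) + if j = y then w (Sum.inl x) else 0 := by
  have hiff : ∀ i : Fin (n + 1), j.val = (i.val + 1) % (n + 1) ↔ i = j - 1 := fun i => by
    rw [eq_sub_iff_add_eq, eq_comm (a := i + 1), Fin.ext_iff, Fin.val_add, Fin.val_one',
      Nat.add_mod_mod]
  simp only [Matrix.vecMul, dotProduct, digraphAdjMatrix, cliqueCycleDigraph, Matrix.of_apply,
    Fintype.sum_sum_type, mul_ite, mul_one, mul_zero, hiff]
  rw [add_comm]
  congr 1
  · simp
  · by_cases hj : j = y <;> simp [hj]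

theorem Fin.val_sub_one_of_pos {n : ℕ} {a : Fin (n + 1)} (ha : a ≠ 0) :
    (a - 1).val + 1 = a.val := by
  rw [Fin.val_sub_one_of_ne_zero ha]
  have := Fin.val_ne_of_ne ha
  simp only [Fin.val_zero] at this
  omega

/-- The vector, normalised to `1` at `y`, that solves every equation of `v A = t v` but the one at
`y`. The sum of its clique entries is `(t + 1 - k)⁻¹`, and `j - y`, taken in `ℤ/(n + 1)`, is the
number of steps from `y` to `j` along the cycle. -/
noncomputable def dominantVector (k n : ℕ) (x : Fin k) (y : Fin (n + 1)) (t : ℝ) :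
    Fin k ⊕ Fin (n + 1) → ℝ
  | Sum.inl i => ((t + 1 - k)⁻¹ + if i = x then 1 else 0) / (t + 1)
  | Sum.inr j => t⁻¹ ^ (j - y).val

theorem dominantVector_pos {k n : ℕ} (x : Fin k) (y : Fin (n + 1)) {t : ℝ} (ht : 0 < t)
    (htk : 0 < t + 1 - k) (i : Fin k ⊕ Fin (n + 1)) : 0 < dominantVector k n x y t i := by
  rcases i with i | j
  · have h1 := inv_pos.mpr htk
    simp only [dominantVector]
    split_ifs <;> positivity
  · simp only [dominantVector]
    positivity

theorem sum_dominantVector_inl {k n : ℕ} (x : Fin k) (y : Fin (n + 1)) {t : ℝ} (ht : 0 < t)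
    (htk : 0 < t + 1 - k) :
    ∑ i, dominantVector k n x y t (Sum.inl i) = (t + 1 - k)⁻¹ := by
  simp only [dominantVector, ← Finset.sum_div, Finset.sum_add_distrib, Finset.sum_ite_eq',
    Finset.mem_univ, if_true, Finset.sum_const, Finset.card_univ, Fintype.card_fin, nsmul_eq_mul]
  have h1 : t + 1 ≠ 0 := by positivity
  have h2 := htk.ne'
  field_simp
  ring

/-- The hypothesis `heq` is the equation of `v A = t v` at `y`, with denominators cleared; the other
equations hold by the choice of the vector. -/
theorem dominantVector_vecMul {k n : ℕ} (x : Fin k) (y : Fin (n + 1)) {t : ℝ} (ht : 0 < t)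
    (htk : 0 < t + 1 - k) (heq : (t + 1 - k) * (t + 1) * (t ^ (n + 1) - 1) = (t + 2 - k) * t ^ n) :
    dominantVector k n x y t ᵥ* digraphAdjMatrix (cliqueCycleDigraph k (n + 1) x y) =
      t • dominantVector k n x y t := by
  have h1 : t + 1 ≠ 0 := by positivity
  have h2 := htk.ne'
  have h3 := ht.ne'
  funext i
  rcases i with j | j
  · rw [vecMul_cliqueCycle_inl, sum_dominantVector_inl x y ht htk]
    simp only [dominantVector, Pi.smul_apply, smul_eq_mul, sub_self, Fin.val_zero, pow_zero]
    field_simp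
    ring
  · rw [vecMul_cliqueCycle_inr]
    simp only [dominantVector, Pi.smul_apply, smul_eq_mul, if_true]
    by_cases hj : j = y
    · subst hj
      have : j - 1 - j = -1 := by abel
      rw [this, Fin.coe_neg_one, sub_self, Fin.val_zero, if_pos rfl, pow_zero, inv_pow]
      field_simp
      linear_combination -heq
    · have : j - 1 - y = j - y - 1 := by abel
      rw [this, if_neg hj, add_zero, ← Fin.val_sub_one_of_pos (sub_ne_zero.mpr hj), pow_succ]
      field_simp

/-- Every eigenvector is determined by its entry at `y`: the sum of its clique entries by adding up
the clique equations, and its cycle entries by induction on the number of steps from `y`. -/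
theorem eq_smul_dominantVector {k n : ℕ} (x : Fin k) (y : Fin (n + 1)) {t : ℝ} (ht : 0 < t)
    (htk : 0 < t + 1 - k) {w : Fin k ⊕ Fin (n + 1) → ℝ}
    (hw : w ᵥ* digraphAdjMatrix (cliqueCycleDigraph k (n + 1) x y) = t • w) :
    w = w (Sum.inr y) • dominantVector k n x y t := by
  have h1 : t + 1 ≠ 0 := by positivity
  have hcl : ∀ i, w (Sum.inl i) =
      (∑ i, w (Sum.inl i) + if i = x then w (Sum.inr y) else 0) / (t + 1) := fun i => by
    have := congrFun hw (Sum.inl i)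
    rw [vecMul_cliqueCycle_inl, Pi.smul_apply, smul_eq_mul] at this
    rw [eq_div_iff h1]
    linear_combination -this
  have hsum : ∑ i, w (Sum.inl i) = w (Sum.inr y) * (t + 1 - k)⁻¹ := by
    have h := Finset.sum_congr rfl fun i (_ : i ∈ Finset.univ) => hcl i
    simp only [← Finset.sum_div, Finset.sum_add_distrib, Finset.sum_ite_eq', Finset.mem_univ,
      if_true, Finset.sum_const, Finset.card_univ, Fintype.card_fin, nsmul_eq_mul] at h
    rw [eq_div_iff h1] at h
    rw [← div_eq_mul_inv, eq_div_iff htk.ne']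
    linear_combination h
  have hcy : ∀ (m : ℕ) (j : Fin (n + 1)), (j - y).val = m →
      w (Sum.inr j) = w (Sum.inr y) * t⁻¹ ^ m := fun m => by
    induction m with
    | zero =>
      intro j hj
      have : j = y := sub_eq_zero.mp (Fin.ext hj)
      rw [this, pow_zero, mul_one]
    | succ m ih =>
      intro j hj
      have hne : j - y ≠ 0 := fun h => by simp [h] at hj
      have hval := Fin.val_sub_one_of_pos hne
      have hprev : j - 1 - y = j - y - 1 := by abel
      have h := congrFun hw (Sum.inr j)
      rw [vecMul_cliqueCycle_inr, if_neg (sub_ne_zero.mp hne), add_zero, Pi.smul_apply,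
        smul_eq_mul, ih (j - 1) (by rw [hprev]; omega)] at h
      rw [pow_succ, ← mul_assoc, h]
      field_simp
  funext i
  rcases i with i | j
  · rw [hcl, hsum, Pi.smul_apply, smul_eq_mul, dominantVector]
    split_ifs <;> ring
  · rw [hcy _ j rfl, Pi.smul_apply, smul_eq_mul, dominantVector]

/-! ### The dominant eigenvalue and the comparison of the bridge nodes -/

theorem exists_root_characteristic_equation {k : ℕ} (hk : 2 ≤ k) (n : ℕ) :
    ∃ t : ℝ, (k : ℝ) - 1 < t ∧
      (t + 1 - k) * (t + 1) * (t ^ (n + 1) - 1) = (t + 2 - k) * t ^ n := by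
  have hk' : (2 : ℝ) ≤ k := by exact_mod_cast hk
  -- At `t = k - 1` the first product vanishes and the difference is `-(k - 1) ^ n < 0`.
  let f : ℝ → ℝ := fun t => (t + 1 - k) * (t + 1) * (t ^ (n + 1) - 1) - (t + 2 - k) * t ^ n
  have hf : Continuous f := by fun_prop
  have hlow : f (k - 1) < 0 := by
    have : 0 < ((k : ℝ) - 1) ^ n := pow_pos (by linarith) n
    simp only [f]
    ring_nf at this ⊢
    linarith
  have hhigh : 0 ≤ f k := by
    have h1 : 1 ≤ (k : ℝ) ^ n := one_le_pow₀ (by linarith)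
    -- At `t = k` the claim is `(k + 1) (k ^ (n + 1) - 1) ≥ 2 k ^ n`.
    have h2 : 2 * (k : ℝ) ^ n ≤ k * k ^ n := by gcongr
    have h3 : (k + 1) * (2 * (k : ℝ) ^ n - 1) ≤ (k + 1) * (k * k ^ n - 1) := by gcongr
    simp only [f, pow_succ]
    nlinarith
  obtain ⟨t, ht, hft⟩ := intermediate_value_Icc (by linarith : (k : ℝ) - 1 ≤ k) hf.continuousOn
    ⟨hlow.le, hhigh⟩
  refine ⟨t, lt_of_le_of_ne ht.1 fun h => ?_, sub_eq_zero.mp hft⟩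
  rw [← h] at hft
  exact hlow.ne hft

theorem dominantVector_bridge_lt {k n : ℕ} (x : Fin k) (y : Fin (n + 1)) {t : ℝ} (ht : 2 ≤ t)
    (h : dominantVector k n x y t ᵥ* digraphAdjMatrix (cliqueCycleDigraph k (n + 1) x y) =
      t • dominantVector k n x y t) (hn : n ≠ 0) :
    dominantVector k n x y t (Sum.inr y) < dominantVector k n x y t (Sum.inl x) := by
  have hy := congrFun h (Sum.inr y)
  have hsub : y - 1 - y = -1 := by abel
  have hval : dominantVector k n x y t (Sum.inr (y - 1)) = t⁻¹ ^ n := by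
    rw [dominantVector, hsub, Fin.coe_neg_one]
  have hone : dominantVector k n x y t (Sum.inr y) = 1 := by
    rw [dominantVector, sub_self, Fin.val_zero, pow_zero]
  rw [vecMul_cliqueCycle_inr, if_pos rfl, Pi.smul_apply, smul_eq_mul, hval, hone] at hy
  have hlt : t⁻¹ ^ n < 1 := pow_lt_one₀ (by positivity) (inv_lt_one_of_one_lt₀ (by linarith)) hn
  rw [hone]
  linarith

theorem mainTheorem4 (k p : ℕ) (hk : 3 ≤ k) (hp : 3 ≤ p) (x : Fin k) (y : Fin p) :
    (∃ v : Fin k ⊕ Fin p → ℝ,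
      (∀ i, 0 < v i) ∧
      IsLeftDominantEigenvector (digraphAdjMatrix (cliqueCycleDigraph k p x y)) v ∧
      ∀ w : Fin k ⊕ Fin p → ℝ,
        IsLeftDominantEigenvector (digraphAdjMatrix (cliqueCycleDigraph k p x y)) w →
          ∃ c : ℝ, w = c • v) ∧
    ∀ v : Fin k ⊕ Fin p → ℝ,
      IsLeftDominantEigenvector (digraphAdjMatrix (cliqueCycleDigraph k p x y)) v →
      (∀ i, 0 ≤ v i) →
        v (Sum.inr y) < v (Sum.inl x) := by
  obtain ⟨n, rfl⟩ : ∃ n, p = n + 1 := ⟨p - 1, by omega⟩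
  obtain ⟨t, hkt, heq⟩ := exists_root_characteristic_equation (by omega : 2 ≤ k) n
  have hk' : (3 : ℝ) ≤ k := by exact_mod_cast hk
  have ht : 0 < t := by linarith
  have htk : 0 < t + 1 - k := by linarith
  have hpos := dominantVector_pos x y ht htk
  have hvec := dominantVector_vecMul x y ht htk heq
  have : Nonempty (Fin k ⊕ Fin (n + 1)) := ⟨Sum.inl x⟩
  have hdom := isDominantEigenvalue_of_pos_left_eigenvector (digraphAdjMatrix_nonneg _) hpos ht hvec
  have huniq : ∀ w : Fin k ⊕ Fin (n + 1) → ℝ,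
      IsLeftDominantEigenvector (digraphAdjMatrix (cliqueCycleDigraph k (n + 1) x y)) w →
        w = w (Sum.inr y) • dominantVector k n x y t := by
    rintro w ⟨-, s, hs, hw⟩
    rw [hs.eq hdom] at hw
    exact eq_smul_dominantVector x y ht htk hw
  refine ⟨⟨dominantVector k n x y t, hpos, ⟨fun h0 => ?_, t, hdom, hvec⟩,
    fun w hw => ⟨_, huniq w hw⟩⟩, fun v hv hnonneg => ?_⟩
  · exact (hpos (Sum.inl x)).ne' (congrFun h0 (Sum.inl x))
  · have hv' := huniq v hv
    have hc : 0 < v (Sum.inr y) := lt_of_le_of_ne (hnonneg _) fun h0 =>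
      hv.1 (by rw [hv', ← h0, zero_smul])
    have hlt := mul_lt_mul_of_pos_left
      (dominantVector_bridge_lt x y (by linarith : (2 : ℝ) ≤ t) hvec (by omega)) hc
    have hx := congrFun hv' (Sum.inl x)
    have hy := congrFun hv' (Sum.inr y)
    rw [Pi.smul_apply, smul_eq_mul] at hx hy
    rwa [← hx, ← hy] at hlt
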